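/- Let $S_\infty$ be the group of permutations of $\{1,2,\dots\}$ fixing all but finitely many elements, $s_i=(i\;i{+}1)$, $S_m=\{w\in S_\infty : w(i)=i \text{ for all } i>m\}$, and let $\ell(w)$ be the number of inversions of $w$. A reduced word of $w$ is a sequence $(i_1,\dots,i_{\ell(w)})$ with $w=s_{i_1}\cdots s_{i_{\ell(w)}}$. On $\mathbb Z[\mathbf t][\mathbf x]$, with $\mathbf x=(x_1,x_2,\dots)$ and $\mathbf t=(t_1,t_2,\dots)$, let $\partial_i f=\frac{f-s_i\cdot f}{x_i-x_{i+1}}$, where $s_i$ swaps $x_i$ and $x_{i+1}$. The double Schubert polynomials $\mathfrak S_w(\mathbf x;\mathbf t)$, $w\in S_\infty$, are the unique family of homogeneous polynomials in $\mathbb Z[\mathbf t][\mathbf x]$ such that $\mathfrak S_w(\mathbf t;\mathbf t)=\delta_{w,\mathrm{id}}$ and, for all $i\ge 1$, $\partial_i\mathfrak S_w=\mathfrak S_{ws_i}$ if $\ell(ws_i)<\ell(w)$ and $\partial_i\mathfrak S_w=0$ otherwise. For $n\ge 0$ let $\widetilde\omega_{[n]}=\omega^{(1)}_{[n]}\omega^{(2)}_{[n]}\cdots\omega^{(n)}_{[n]}$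 be the concatenation of the words $$\omega^{(k)}_{[n]}=\bigl(n^{(k)},(n-1)^{(k)},\dots,(k+1)^{(k)},k^{(k)},\overline{k+1}^{(k)},\dots,\overline{n-1}^{(k)},\overline{n}^{(k)}\bigr),$$ where the letters $j^{(k)}$ and $\overline{j}^{(k)}$ both have value $j$, and weights $\operatorname{wt}(j^{(k)})=x_k-t_j$ and $\operatorname{wt}(\overline{j}^{(k)})=t_j-t_k$. For $w\in S_\infty$ let $\mathcal R(\widetilde\omega_{[n]};w)$ be the set of subwords $\pi$ of $\widetilde\omega_{[n]}$ (one for each choice of a set of positions) whose sequence of values is a reduced word of $w$, and let $\operatorname{wt}(\pi)$ be the product of the weights of the letters of $\pi$. Theorem. The family of double Schubert polynomials exists and is unique, and for every $n\ge 0$ and every $w\in S_{n+1}$, $$\mathfrak S_w(\mathbf x;\mathbf t)=\sum_{\pi\in\mathcal R(\widetilde\omega_{[n]};w)}\operatorname{wt}(\pi).$$ -/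

import Mathlib

/-!
Indexing convention: the positive integers `1, 2, 3, …` are represented by the natural
numbers `0, 1, 2, …`.  So the natural number `i` stands for the usual index `i + 1`, both for
points permuted, for simple transpositions, for variables and for letters of words.
-/

namespace VineModel

/-- The polynomial ring `ℤ[t][x]` in two infinite families of variables. -/
abbrev Poly : Type := MvPolynomial (ℕ ⊕ ℕ) ℤ

/-- The variable `x_i`. -/
noncomputable def xv (i : ℕ) : Poly := MvPolynomial.X (Sum.inl i)

/-- The variable `t_i`. -/
noncomputable def tv (i : ℕ) : Poly := MvPolynomial.X (Sum.inr i)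

/-- `S_∞`: the permutations that fix all but finitely many elements. -/
def SInf : Subgroup (Equiv.Perm ℕ) where
  carrier := {w | {i | w i ≠ i}.Finite}
  one_mem' := by simp
  mul_mem' := by
    intro u v hu hv
    refine (Set.Finite.union hu hv).subset ?_
    intro i hi
    by_contra h
    simp only [Set.mem_union, Set.mem_ofPred_eq, not_or, not_not] at h
    exact hi (by rw [Equiv.Perm.mul_apply, h.2, h.1])
  inv_mem' := by
    intro w hw
    refine Set.Finite.subset hw ?_
    intro i hi h
    exact hi (by rw [Equiv.Perm.inv_eq_iff_eq]; exact h.symm)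

/-- `S_n`, as the subgroup of `S_∞` of the permutations that fix every element after the first
`n` elements (that is, every natural number `≥ n`). -/
def symmetricSubgroup (n : ℕ) : Subgroup SInf where
  carrier := {w | ∀ i, n ≤ i → w.1 i = i}
  one_mem' := by intro i _; rfl
  mul_mem' := by
    intro u v hu hv i hi
    change u.1 (v.1 i) = i
    rw [hv i hi, hu i hi]
  inv_mem' := by
    intro w hw i hi
    change (w.1)⁻¹ i = i
    rw [Equiv.Perm.inv_eq_iff_eq]
    exact (hw i hi).symm

/-- The adjacent transposition `s_i = (i, i+1)`. -/
def simpleTransposition (i : ℕ) : SInf :=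
  ⟨Equiv.swap i (i + 1), by
    refine (Set.toFinite ({i, i + 1} : Set ℕ)).subset ?_
    intro j hj
    by_contra h
    simp only [Set.mem_insert_iff, Set.mem_singleton_iff, not_or] at h
    exact hj (Equiv.swap_apply_of_ne_of_ne h.1 h.2)⟩

/-- The length `ℓ(w)`: the number of inversions of `w`. -/
noncomputable def length (w : SInf) : ℕ :=
  {p : ℕ × ℕ | p.1 < p.2 ∧ w.1 p.2 < w.1 p.1}.ncard

/-- The set of reduced words of `w`: words `(i_1, …, i_ℓ)` with `ℓ = ℓ(w)` and
`w = s_{i_1} ⋯ s_{i_ℓ}`. -/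
def reducedWords (w : SInf) : Set (List ℕ) :=
  {l | (l.map simpleTransposition).prod = w ∧ l.length = length w}

/-- The action of `S_∞` on `ℤ[t][x]` by permuting the `x`-variables, `x_j ↦ x_{w(j)}`. -/
noncomputable def act (w : SInf) (f : Poly) : Poly :=
  MvPolynomial.rename (Sum.map w.1 id) f

theorem exists_dividedDifference (i : ℕ) (f : Poly) :
    ∃ g : Poly, (xv i - xv (i + 1)) * g = f - act (simpleTransposition i) f := by
  suffices h : (xv i - xv (i + 1)) ∣ f - act (simpleTransposition i) f by
    obtain ⟨g, hg⟩ := h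
    exact ⟨g, hg.symm⟩
  have key : ∀ v : ℕ ⊕ ℕ, (xv i - xv (i + 1)) ∣
      (MvPolynomial.X v : Poly) - act (simpleTransposition i) (MvPolynomial.X v) := by
    rintro (j | j)
    · have hj : act (simpleTransposition i) (MvPolynomial.X (Sum.inl j)) =
          xv (Equiv.swap i (i + 1) j) := by
        simp [act, xv, simpleTransposition]
      rw [hj]
      rcases eq_or_ne j i with rfl | h1
      · rw [Equiv.swap_apply_left]
        exact dvd_rfl
      · rcases eq_or_ne j (i + 1) with rfl | h2
        · rw [Equiv.swap_apply_right]
          exact ⟨-1, by simp [xv]⟩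
        · rw [Equiv.swap_apply_of_ne_of_ne h1 h2]
          simp [xv]
    · simp [act]
  induction f using MvPolynomial.induction_on with
  | C a => simp [act]
  | add p q hp hq =>
    have : p + q - act (simpleTransposition i) (p + q) =
        (p - act (simpleTransposition i) p) + (q - act (simpleTransposition i) q) := by
      simp only [act, map_add]; ring
    rw [this]
    exact dvd_add hp hq
  | mul_X p v hp =>
    have : p * MvPolynomial.X v - act (simpleTransposition i) (p * MvPolynomial.X v) =
        (p - act (simpleTransposition i) p) * MvPolynomial.X v +
        act (simpleTransposition i) p *
          (MvPolynomial.X v - act (simpleTransposition i) (MvPolynomial.X v)) := by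
      simp only [act, map_mul]; ring
    rw [this]
    exact dvd_add (hp.mul_right _) ((key v).mul_left _)

/-- The divided difference `∂_i f = (f - s_i · f) / (x_i - x_{i+1})`. -/
noncomputable def dividedDifference (i : ℕ) (f : Poly) : Poly :=
  Classical.choose (exists_dividedDifference i f)

/-- The defining property of `∂_i f`; it determines `∂_i f` since `ℤ[t][x]` is a domain. -/
theorem dividedDifference_spec (i : ℕ) (f : Poly) :
    (xv i - xv (i + 1)) * dividedDifference i f = f - act (simpleTransposition i) f :=
  Classical.choose_spec (exists_dividedDifference i f)

/-- The specialization `f(x;t) ↦ f(t;t)`. -/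
noncomputable def evalAtT (f : Poly) : Poly :=
  MvPolynomial.aeval (Sum.elim tv tv) f

open scoped Classical in
/-- The characterization of the family of double Schubert polynomials `𝔖_w(x;t)`, `w ∈ S_∞`:
each is homogeneous (in the `x`- and `t`-variables together), `𝔖_w(t;t) = δ_{w,id}`, and
`∂_i 𝔖_w` is `𝔖_{w s_i}` if `ℓ(w s_i) < ℓ(w)` and `0` otherwise. -/
structure IsDoubleSchubertFamily (S : SInf → Poly) : Prop where
  homogeneous : ∀ w, ∃ d : ℕ, (S w).IsHomogeneous d
  normalization : ∀ w, evalAtT (S w) = if w = 1 then 1 else 0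
  recursion : ∀ w i, dividedDifference i (S w) =
    if length (w * simpleTransposition i) < length w then S (w * simpleTransposition i) else 0

/-- A decorated letter of the long word. `⟨i, j, false⟩` is the unbarred letter `j^{(i)}` and
`⟨i, j, true⟩` is the barred letter `\overline{j}^{(i)}`; here `i` is the syllable and `j` the
value. -/
structure Letter where
  syllable : ℕ
  value : ℕ
  barred : Bool

/-- The weight of a letter: `x_i - t_j` for `j^{(i)}` and `t_j - t_i` for `\overline{j}^{(i)}`. -/
noncomputable def Letter.weight (a : Letter) : Poly :=
  if a.barred then tv a.value - tv a.syllable else xv a.syllable - tv a.value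

/-- The syllable `n, n-1, …, k+1, k, \overline{k+1}, …, \overline{n}`; with indices starting at
`0` the values run from `n - 1` down to `k`, then from `k + 1` up to `n - 1`. -/
def syllableWord (n k : ℕ) : List Letter :=
  (List.range' k (n - k)).reverse.map (fun j => ⟨k, j, false⟩) ++
    (List.range' (k + 1) (n - 1 - k)).map (fun j => ⟨k, j, true⟩)

/-- The long word: the concatenation of its `n` syllables in order. -/
def longWord (n : ℕ) : List Letter :=
  (List.range n).flatMap (syllableWord n)

/-- The weight of a (sub)word: the product of the weights of its letters. -/
noncomputable def wordWeight (π : List Letter) : Poly :=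
  (π.map Letter.weight).prod

open scoped Classical in
/-- The subword generating function: the sum of the weights of the subwords of `ω` whose word of
values lies in `D`. Here `ω.sublists` lists the subwords of `ω`, once for each choice of a set of
positions. -/
noncomputable def subwordSum (ω : List Letter) (D : Set (List ℕ)) : Poly :=
  ((ω.sublists.filter (fun π => π.map Letter.value ∈ D)).map wordWeight).sum

end VineModel

/-! In the style of Fomin and Kirillov, the subword sums for all `w` are collected into one element
of the nilCoxeter algebra: the product `G` over the letters of the long word of the factors `1 + wt
· u_value`, whose coefficient at `u_w` is the sum for `w` (`map_subwordSum`). `G` factors into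
syllables `B_k(x_k)`, and two identities suffice.

The barred half of a syllable is the inverse of the unbarred half at `x = t_k`, so `B_k(t_k) = 1`
and `G` specializes to `1` at `x = t`: this is the normalization. The Yang–Baxter equation gives
`B_i(y) B_{i+1}(x) = B_i(x) B_{i+1}(y) (1 + (y - x) u_i)` (`syllableProd_exchange`), hence `s_i · G
= G (1 + (x_{i+1} - x_i) u_i)`; comparing coefficients of `u_w` gives the divided difference
recursion.

Conversely, by induction on length, the difference of two solutions at `w` is fixed by every `s_i`.
A polynomial involves finitely many variables, so it contains no `x`, and it equals its value at `x
= t`, which is `0` (`eq_zero_of_symmetric`). This also shows that the sums do not depend on `n`,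
which gives existence. -/

namespace VineModel

/-! ### Yang–Baxter identities in a nilCoxeter algebra -/

section NilCoxeter

/-- The relations of the nilCoxeter algebra of `S_∞`. -/
structure IsNilCoxeter {A : Type*} [Ring A] (u : ℕ → A) : Prop where
  sq : ∀ i, u i * u i = 0
  comm : ∀ i j, i + 1 < j → u i * u j = u j * u i
  braid : ∀ i, u i * u (i + 1) * u i = u (i + 1) * u i * u (i + 1)

variable {R A : Type*} [CommRing R] [Ring A] [Algebra R A]

/-- The exponential `1 + a u_i` of `a u_i` in a nilCoxeter algebra. -/
def nilExp (u : ℕ → A) (i : ℕ) (a : R) : A := 1 + a • u i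

/-- The product of the `1 + (x - t_j) u_j` for `j` descending from `m + d - 1` to `m`. -/
def descProd (u : ℕ → A) (t : ℕ → R) (x : R) (m : ℕ) : ℕ → A
  | 0 => 1
  | d + 1 => descProd u t x (m + 1) d * nilExp u m (x - t m)

/-- The product of the `1 + (t_j - c) u_j` for `j` ascending from `m` to `m + d - 1`. -/
def ascProd (u : ℕ → A) (t : ℕ → R) (c : R) (m : ℕ) : ℕ → A
  | 0 => 1
  | d + 1 => nilExp u m (t m - c) * ascProd u t c (m + 1) d

/-- The product attached to a syllable, with `x`-variable specialized to `x`. -/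
def syllableProd (u : ℕ → A) (t : ℕ → R) (n k : ℕ) (x : R) : A :=
  descProd u t x k (n - k) * ascProd u t (t k) (k + 1) (n - 1 - k)

variable {u : ℕ → A}

theorem nilExp_zero (i : ℕ) : nilExp u i (0 : R) = 1 := by simp [nilExp]

theorem IsNilCoxeter.nilExp_mul (hu : IsNilCoxeter u) (i : ℕ) (a b : R) :
    nilExp u i a * nilExp u i b = nilExp u i (a + b) := by
  simp only [nilExp, add_mul, mul_add, one_mul, mul_one, smul_mul_assoc, mul_smul_comm, hu.sq]
  module

theorem IsNilCoxeter.commute_nilExp (hu : IsNilCoxeter u) {i j : ℕ} (hij : i + 1 < j) (a b : R) :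
    Commute (nilExp u i a) (nilExp u j b) :=
  (Commute.one_left _).add_left (((Commute.one_right _).add_right
    (Commute.smul_right (hu.comm i j hij) b)).smul_left a)

/-- The quadratic and cubic terms agree by the nilCoxeter relations alone; the linear terms agree
because `b = a + c`. -/
theorem IsNilCoxeter.yangBaxter (hu : IsNilCoxeter u) (i : ℕ) (a b c : R) (h : b = a + c) :
    nilExp u i a * nilExp u (i + 1) b * nilExp u i c =
      nilExp u (i + 1) c * nilExp u i b * nilExp u (i + 1) a := by
  subst h
  simp only [nilExp, add_mul, mul_add, one_mul, mul_one, smul_mul_assoc, mul_smul_comm, hu.sq,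
    hu.braid, smul_add]
  module

theorem IsNilCoxeter.commute_descProd (hu : IsNilCoxeter u) (t : ℕ → R) (a x : R) {i m : ℕ}
    (him : i + 1 < m) (d : ℕ) : Commute (nilExp u i a) (descProd u t x m d) := by
  induction d generalizing m with
  | zero => exact Commute.one_right _
  | succ d ih => exact (ih (by omega)).mul_right (hu.commute_nilExp him _ _)

theorem IsNilCoxeter.commute_ascProd (hu : IsNilCoxeter u) (t : ℕ → R) (a x : R) {i m : ℕ}
    (him : i + 1 < m) (d : ℕ) : Commute (nilExp u i a) (ascProd u t x m d) := by
  induction d generalizing m with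
  | zero => exact Commute.one_right _
  | succ d ih => exact (hu.commute_nilExp him _ _).mul_right (ih (by omega))

theorem IsNilCoxeter.commute_syllableProd (hu : IsNilCoxeter u) (t : ℕ → R) (a x : R) {i k : ℕ}
    (hik : i + 1 < k) (n : ℕ) : Commute (nilExp u i a) (syllableProd u t n k x) :=
  (hu.commute_descProd t a x hik _).mul_right (hu.commute_ascProd t a _ (by omega) _)

/-- The two innermost factors have opposite parameters, so the product telescopes from the middle.
-/
theorem IsNilCoxeter.descProd_mul_ascProd (hu : IsNilCoxeter u) (t : ℕ → R) (c : R) (m d : ℕ) :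
    descProd u t c m d * ascProd u t c m d = 1 := by
  induction d generalizing m with
  | zero => simp [descProd, ascProd]
  | succ d ih =>
    rw [descProd, ascProd, mul_assoc, ← mul_assoc (nilExp _ _ _), hu.nilExp_mul]
    simp [nilExp_zero, ih]

/-- The core of the exchange of two neighbouring syllables. Keeping `c` independent of `t` lets the
induction move from `m` to `m + 1` with the same `c`. -/
theorem IsNilCoxeter.descProd_exchange (hu : IsNilCoxeter u) (t : ℕ → R) (x y c : R) (m d : ℕ) :
    descProd u t y (m + 1) d * nilExp u m (y - c) * ascProd u t c (m + 1) d *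
        descProd u t x (m + 1) d =
      descProd u t x (m + 1) d * nilExp u m (x - c) * ascProd u t c (m + 1) d *
        descProd u t y (m + 1) d * nilExp u m (y - x) := by
  induction d generalizing m with
  | zero => simp [descProd, ascProd, hu.nilExp_mul]
  | succ d ih =>
    simp only [descProd, ascProd]
    set e := t (m + 1)
    have hD (a z : R) := hu.commute_descProd t a z (show m + 1 < m + 1 + 1 by omega) d
    have hA (a : R) := hu.commute_ascProd t a c (show m + 1 < m + 1 + 1 by omega) d
    -- Used at `z = y` to create the middle factor `y - c` at index `m + 1` that the induction
    -- hypothesis needs, and at `z = x` to undo this afterwards; `yb2` carries the factor `y - x`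
    -- down to index `m`.
    have yb1 (z : R) := hu.yangBaxter m (e - c) (z - c) (z - e) (by ring)
    have yb2 := hu.yangBaxter m (x - e) (y - e) (y - x) (by ring)
    calc _ = descProd u t y (m + 1 + 1) d * (nilExp u (m + 1) (y - e) * nilExp u m (y - c) *
          nilExp u (m + 1) (e - c)) * ascProd u t c (m + 1 + 1) d *
          descProd u t x (m + 1 + 1) d * nilExp u (m + 1) (x - e) := by simp only [mul_assoc]
      _ = nilExp u m (e - c) * (descProd u t y (m + 1 + 1) d * nilExp u (m + 1) (y - c) *
          ascProd u t c (m + 1 + 1) d * descProd u t x (m + 1 + 1) d) *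
          nilExp u m (y - e) * nilExp u (m + 1) (x - e) := by
        rw [← yb1]
        simp only [mul_assoc, (hD _ _).left_comm, (hA _).left_comm]
      _ = nilExp u m (e - c) * descProd u t x (m + 1 + 1) d * nilExp u (m + 1) (x - c) *
          ascProd u t c (m + 1 + 1) d * descProd u t y (m + 1 + 1) d *
          (nilExp u (m + 1) (y - x) * nilExp u m (y - e) * nilExp u (m + 1) (x - e)) := by
        rw [ih]; simp only [mul_assoc]
      _ = descProd u t x (m + 1 + 1) d *
          (nilExp u m (e - c) * nilExp u (m + 1) (x - c) * nilExp u m (x - e)) *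
          ascProd u t c (m + 1 + 1) d * descProd u t y (m + 1 + 1) d *
          nilExp u (m + 1) (y - e) * nilExp u m (y - x) := by
        rw [← yb2]
        simp only [mul_assoc, (hD _ _).left_comm, (hA _).left_comm]
      _ = _ := by rw [yb1]; simp only [mul_assoc]

theorem IsNilCoxeter.syllableProd_self (hu : IsNilCoxeter u) (t : ℕ → R) {n k : ℕ} (hk : k < n) :
    syllableProd u t n k (t k) = 1 := by
  obtain ⟨d, rfl⟩ := Nat.exists_eq_add_of_lt hk
  rw [syllableProd, show k + d + 1 - k = d + 1 by omega, show k + d + 1 - 1 - k = d by omega,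
    descProd, sub_self, nilExp_zero, mul_one, hu.descProd_mul_ascProd]

theorem IsNilCoxeter.syllableProd_exchange (hu : IsNilCoxeter u) (t : ℕ → R) (x y : R) {n i : ℕ}
    (hi : i + 1 < n) :
    syllableProd u t n i y * syllableProd u t n (i + 1) x =
      syllableProd u t n i x * syllableProd u t n (i + 1) y * nilExp u i (y - x) := by
  obtain ⟨d, rfl⟩ := Nat.exists_eq_add_of_lt hi
  simp only [syllableProd]
  rw [show i + 1 + d + 1 - i = d + 1 + 1 by omega, show i + 1 + d + 1 - 1 - i = d + 1 by omega,
    show i + 1 + d + 1 - (i + 1) = d + 1 by omega, show i + 1 + d + 1 - 1 - (i + 1) = d by omega,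
    descProd, descProd.eq_2 u t x i]
  -- Here `c = t i`. The barred letters of syllable `i + 1` have index at least `i + 2`, so the new
  -- factor at `i` passes them.
  have key := hu.descProd_exchange t x y (t i) i (d + 1)
  have hA := hu.commute_ascProd t (y - x) (t (i + 1)) (show i + 1 < i + 1 + 1 by omega) d
  rw [← mul_assoc, key]
  simp only [mul_assoc, hA.eq]

/-- Only syllables `i` and `i + 1` change, and the factor they emit commutes with all later
syllables. -/
theorem IsNilCoxeter.prod_syllableProd_swap (hu : IsNilCoxeter u) (t x : ℕ → R) {n i : ℕ}
    (hi : i < n) :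
    ((List.range n).map fun k => syllableProd u t n k (x (Equiv.swap i (i + 1) k))).prod =
      ((List.range n).map fun k => syllableProd u t n k (x k)).prod *
        nilExp u i (x (i + 1) - x i) := by
  have hpre : (List.range i).map (fun k => syllableProd u t n k (x (Equiv.swap i (i + 1) k))) =
      (List.range i).map (fun k => syllableProd u t n k (x k)) := by
    refine List.map_congr_left fun k hk => ?_
    rw [List.mem_range] at hk
    rw [Equiv.swap_apply_of_ne_of_ne (by omega) (by omega)]
  rcases Nat.lt_or_ge (i + 1) n with h | h
  · obtain ⟨e, he⟩ := Nat.exists_eq_add_of_le (show i + 2 ≤ n from h)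
    have hsplit (f : ℕ → A) : ((List.range n).map f).prod =
        ((List.range i).map f).prod * (f i * f (i + 1)) *
          ((List.range e).map fun k => f (i + 2 + k)).prod := by
      rw [he, List.range_add, List.range_succ, List.range_succ]
      simp [mul_assoc, Function.comp_def]
    have hcomm : Commute (nilExp u i (x (i + 1) - x i))
        ((List.range e).map fun k => syllableProd u t n (i + 2 + k) (x (i + 2 + k))).prod := by
      refine Commute.list_prod_right _ _ fun b hb => ?_
      obtain ⟨k, -, rfl⟩ := List.mem_map.1 hb
      exact hu.commute_syllableProd t _ _ (by omega) n
    have hsuf : (List.range e).map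
        (fun k => syllableProd u t n (i + 2 + k) (x (Equiv.swap i (i + 1) (i + 2 + k)))) =
        (List.range e).map (fun k => syllableProd u t n (i + 2 + k) (x (i + 2 + k))) := by
      refine List.map_congr_left fun k _ => ?_
      rw [Equiv.swap_apply_of_ne_of_ne (by omega) (by omega)]
    rw [hsplit, hsplit, hpre, hsuf, Equiv.swap_apply_left, Equiv.swap_apply_right,
      hu.syllableProd_exchange t _ _ h]
    simp only [mul_assoc, hcomm.eq]
  -- The last syllable is a single letter, and `x (i + 1)` belongs to no syllable: two factors with
  -- the same generator simply add.
  · obtain rfl : n = i + 1 := by omega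
    simp only [List.range_succ, List.map_append, List.prod_append, hpre, List.map_singleton,
      List.prod_singleton, Equiv.swap_apply_left]
    simp [syllableProd, descProd, ascProd, mul_assoc, hu.nilExp_mul]

end NilCoxeter



/-! ### Length, descents and reduced words -/

section Length

theorem simpleTransposition_mul_self (i : ℕ) :
    simpleTransposition i * simpleTransposition i = 1 :=
  Subtype.ext (Equiv.swap_mul_self i (i + 1))

theorem mul_simpleTransposition_cancel (w : SInf) (i : ℕ) :
    w * simpleTransposition i * simpleTransposition i = w := by
  rw [mul_assoc, simpleTransposition_mul_self, mul_one]

theorem mul_simpleTransposition_apply (w : SInf) (i j : ℕ) :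
    (w * simpleTransposition i).1 j = w.1 (Equiv.swap i (i + 1) j) := rfl

theorem mul_simpleTransposition_apply_left (w : SInf) (i : ℕ) :
    (w * simpleTransposition i).1 i = w.1 (i + 1) := by
  rw [mul_simpleTransposition_apply, Equiv.swap_apply_left]

theorem mul_simpleTransposition_apply_right (w : SInf) (i : ℕ) :
    (w * simpleTransposition i).1 (i + 1) = w.1 i := by
  rw [mul_simpleTransposition_apply, Equiv.swap_apply_right]

theorem mul_simpleTransposition_apply_of_ne (w : SInf) {i j : ℕ} (h : j ≠ i) (h' : j ≠ i + 1) :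
    (w * simpleTransposition i).1 j = w.1 j := by
  rw [mul_simpleTransposition_apply, Equiv.swap_apply_of_ne_of_ne h h']

theorem exists_mem_symmetricSubgroup (w : SInf) : ∃ n, w ∈ symmetricSubgroup n := by
  obtain ⟨N, hN⟩ := w.2.bddAbove
  refine ⟨N + 1, fun i hi => ?_⟩
  by_contra h
  exact absurd (hN h) (by omega)

theorem finite_inversions (w : SInf) : {p : ℕ × ℕ | p.1 < p.2 ∧ w.1 p.2 < w.1 p.1}.Finite := by
  obtain ⟨N, hN⟩ := exists_mem_symmetricSubgroup w
  refine ((Set.finite_Iio N).prod (Set.finite_Iio N)).subset ?_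
  rintro ⟨p, q⟩ ⟨hpq, hw⟩
  simp only at hpq hw
  suffices q < N from ⟨hpq.trans this, this⟩
  by_contra! hq
  rw [hN q hq] at hw
  have := w.1.injective (hN (w.1 p) (by omega))
  omega

/-- Applying `s_i` to both entries sends the inversions of `w` bijectively to those of `w s_i` other
than `(i, i + 1)`. -/
theorem length_mul_simpleTransposition_of_lt {w : SInf} {i : ℕ} (h : w.1 i < w.1 (i + 1)) :
    length (w * simpleTransposition i) = length w + 1 := by
  set s := Equiv.swap i (i + 1) with hs
  have hlt : ∀ p q, p < q → (p, q) ≠ (i, i + 1) → s p < s q := by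
    intro p q hpq hne
    simp only [ne_eq, Prod.mk.injEq] at hne
    simp only [hs, Equiv.swap_apply_def]
    split_ifs <;> omega
  have hss : ∀ p, s (s p) = p := fun p => by rw [hs, ← Equiv.Perm.mul_apply, Equiv.swap_mul_self, Equiv.Perm.one_apply]
  have hset : {p : ℕ × ℕ | p.1 < p.2 ∧
      (w * simpleTransposition i).1 p.2 < (w * simpleTransposition i).1 p.1} =
      insert (i, i + 1) (Prod.map s s '' {p : ℕ × ℕ | p.1 < p.2 ∧ w.1 p.2 < w.1 p.1}) := by
    ext ⟨p, q⟩
    simp only [mul_simpleTransposition_apply, ← hs, Set.mem_insert_iff, Set.mem_image,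
      Set.mem_ofPred_eq, Prod.exists, Prod.map_apply]
    constructor
    · rintro ⟨hpq, hw⟩
      refine or_iff_not_imp_left.2 fun hne => ⟨s p, s q, ⟨hlt p q hpq hne, hw⟩, ?_⟩
      rw [hss, hss]
    · rintro (hp | ⟨a, b, ⟨hab, hw⟩, hp⟩)
      · obtain ⟨rfl, rfl⟩ := Prod.mk.inj hp
        refine ⟨Nat.lt_succ_self _, ?_⟩
        rwa [hs, Equiv.swap_apply_left, Equiv.swap_apply_right]
      · obtain ⟨rfl, rfl⟩ := Prod.mk.inj hp
        rw [hss, hss]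
        refine ⟨hlt a b hab fun hab' => ?_, hw⟩
        obtain ⟨rfl, rfl⟩ := Prod.mk.inj hab'
        omega
  have hnot : (i, i + 1) ∉ Prod.map s s '' {p : ℕ × ℕ | p.1 < p.2 ∧ w.1 p.2 < w.1 p.1} := by
    rintro ⟨⟨a, b⟩, ⟨hab, -⟩, hp⟩
    obtain ⟨ha, hb⟩ := Prod.mk.inj hp
    have ha' : a = i + 1 := by rw [← hss a, ha, hs, Equiv.swap_apply_left]
    have hb' : b = i := by rw [← hss b, hb, hs, Equiv.swap_apply_right]
    simp only at hab
    omega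
  rw [length, length, hset, Set.ncard_insert_of_notMem hnot ((finite_inversions w).image _),
    Set.ncard_image_of_injective _ (s.injective.prodMap s.injective)]

theorem apply_lt_or_gt (w : SInf) (i : ℕ) : w.1 i < w.1 (i + 1) ∨ w.1 (i + 1) < w.1 i :=
  lt_or_gt_of_ne (w.1.injective.ne (by omega))

theorem length_mul_simpleTransposition_of_gt {w : SInf} {i : ℕ} (h : w.1 (i + 1) < w.1 i) :
    length w = length (w * simpleTransposition i) + 1 := by
  have := length_mul_simpleTransposition_of_lt (w := w * simpleTransposition i) (i := i)
    (by rwa [mul_simpleTransposition_apply_left, mul_simpleTransposition_apply_right])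
  rwa [mul_simpleTransposition_cancel] at this

theorem length_mul_simpleTransposition_lt_iff (w : SInf) (i : ℕ) :
    length (w * simpleTransposition i) < length w ↔ w.1 (i + 1) < w.1 i := by
  rcases apply_lt_or_gt w i with h | h
  · have := length_mul_simpleTransposition_of_lt h
    omega
  · have := length_mul_simpleTransposition_of_gt h
    omega

theorem length_one : length 1 = 0 := by
  have : {p : ℕ × ℕ | p.1 < p.2 ∧ (1 : SInf).1 p.2 < (1 : SInf).1 p.1} = ∅ := by
    refine Set.eq_empty_of_forall_notMem ?_
    rintro ⟨p, q⟩ ⟨h1, h2⟩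
    exact lt_asymm h1 h2
  rw [length, this, Set.ncard_empty]

theorem length_prod_le (l : List ℕ) : length (l.map simpleTransposition).prod ≤ l.length := by
  induction l using List.reverseRecOn with
  | nil => simp [length_one]
  | append_singleton l i ih =>
    simp only [List.map_append, List.prod_append, List.map_singleton, List.prod_singleton,
      List.length_append, List.length_singleton]
    rcases apply_lt_or_gt (l.map simpleTransposition).prod i with h | h
    · have := length_mul_simpleTransposition_of_lt h
      omega
    · have := length_mul_simpleTransposition_of_gt h
      omega

/-- Removing the last letter of a reduced word must lower the length by one. This recursion matches
the action of `u_i` in `nilGenEnd`. -/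
theorem append_mem_reducedWords_iff (l : List ℕ) (i : ℕ) (w : SInf) :
    l ++ [i] ∈ reducedWords w ↔
      w.1 (i + 1) < w.1 i ∧ l ∈ reducedWords (w * simpleTransposition i) := by
  simp only [reducedWords, Set.mem_ofPred_eq, List.map_append, List.prod_append, List.map_singleton,
    List.prod_singleton, List.length_append, List.length_singleton]
  constructor
  · rintro ⟨rfl, hl⟩
    rw [mul_simpleTransposition_cancel]
    have hle := length_prod_le l
    rcases apply_lt_or_gt (l.map simpleTransposition).prod i with h | h
    · have := length_mul_simpleTransposition_of_lt h
      rw [mul_simpleTransposition_apply_left, mul_simpleTransposition_apply_right]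
      exact ⟨h, rfl, by omega⟩
    · have := length_mul_simpleTransposition_of_gt h
      omega
  · rintro ⟨h, hw, hl⟩
    rw [hw, mul_simpleTransposition_cancel]
    exact ⟨rfl, by rw [hl, length_mul_simpleTransposition_of_gt h]⟩

theorem nil_mem_reducedWords_iff (w : SInf) : [] ∈ reducedWords w ↔ w = 1 := by
  constructor
  · rintro ⟨h, -⟩
    exact h.symm
  · rintro rfl
    exact ⟨rfl, length_one.symm⟩

theorem mul_simpleTransposition_mem {n : ℕ} {w : SInf} (hw : w ∈ symmetricSubgroup (n + 1)) {i : ℕ}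
    (hi : i < n) : w * simpleTransposition i ∈ symmetricSubgroup (n + 1) := fun j hj => by
  rw [mul_simpleTransposition_apply_of_ne _ (by omega) (by omega), hw j hj]

theorem lt_of_descent {n : ℕ} {w : SInf} (hw : w ∈ symmetricSubgroup (n + 1)) {i : ℕ}
    (h : w.1 (i + 1) < w.1 i) : i < n := by
  by_contra! hi
  have h1 := hw (i + 1) (by omega)
  rw [h1] at h
  have := w.1.injective (hw (w.1 i) (by omega))
  omega

end Length

/-! ### The nilCoxeter algebra acting on formal sums -/

section NilCoxeterModule

open scoped Classical in
/-- Right multiplication by the generator `u_i` of the nilCoxeter algebra on formal sums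
`∑ f(w) u_w`. -/
noncomputable def nilGenEnd (i : ℕ) : Module.End Poly (SInf → Poly) where
  toFun f w := if w.1 (i + 1) < w.1 i then f (w * simpleTransposition i) else 0
  map_add' f g := by
    ext1 w
    simp only [Pi.add_apply]
    split_ifs <;> simp
  map_smul' a f := by
    ext1 w
    simp only [Pi.smul_apply, RingHom.id_apply]
    split_ifs <;> simp

theorem nilGenEnd_apply (i : ℕ) (f : SInf → Poly) (w : SInf) :
    nilGenEnd i f w = if w.1 (i + 1) < w.1 i then f (w * simpleTransposition i) else 0 := by
  simp [nilGenEnd]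

/-- The generators of the nilCoxeter algebra, multiplied in the order of right actions. -/
noncomputable def nilGen (i : ℕ) : (Module.End Poly (SInf → Poly))ᵐᵒᵖ :=
  MulOpposite.op (nilGenEnd i)

theorem simpleTransposition_comm {i j : ℕ} (h : i + 1 < j) :
    simpleTransposition i * simpleTransposition j =
      simpleTransposition j * simpleTransposition i := by
  refine Subtype.ext (Equiv.ext fun k => ?_)
  change Equiv.swap i (i + 1) (Equiv.swap j (j + 1) k) =
    Equiv.swap j (j + 1) (Equiv.swap i (i + 1) k)
  simp only [Equiv.swap_apply_def]
  split_ifs <;> omega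

theorem simpleTransposition_braid (i : ℕ) :
    simpleTransposition i * simpleTransposition (i + 1) * simpleTransposition i =
      simpleTransposition (i + 1) * simpleTransposition i * simpleTransposition (i + 1) := by
  refine Subtype.ext (Equiv.ext fun k => ?_)
  change Equiv.swap i (i + 1) (Equiv.swap (i + 1) (i + 1 + 1) (Equiv.swap i (i + 1) k)) =
    Equiv.swap (i + 1) (i + 1 + 1) (Equiv.swap i (i + 1) (Equiv.swap (i + 1) (i + 1 + 1) k))
  simp only [Equiv.swap_apply_def]
  split_ifs <;> omega

/-- For the square, `w` and `w s_i` cannot both descend at `i`. For the braid relation, both sides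
survive exactly when `w` reverses `i, i + 1, i + 2`. -/
theorem isNilCoxeter_nilGen : IsNilCoxeter nilGen where
  sq i := by
    refine MulOpposite.unop_injective (LinearMap.ext fun f => funext fun w => ?_)
    change nilGenEnd i (nilGenEnd i f) w = 0
    simp only [nilGenEnd_apply, mul_simpleTransposition_apply_left,
      mul_simpleTransposition_apply_right]
    split_ifs with h1 h2
    · exact absurd h1 h2.asymm
    · rfl
    · rfl
  comm i j h := by
    refine MulOpposite.unop_injective (LinearMap.ext fun f => funext fun w => ?_)
    change nilGenEnd j (nilGenEnd i f) w = nilGenEnd i (nilGenEnd j f) w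
    simp only [nilGenEnd_apply]
    rw [mul_simpleTransposition_apply_of_ne w (i := j) (j := i) (by omega) (by omega),
      mul_simpleTransposition_apply_of_ne w (i := j) (j := i + 1) (by omega) (by omega),
      mul_simpleTransposition_apply_of_ne w (i := i) (j := j) (by omega) (by omega),
      mul_simpleTransposition_apply_of_ne w (i := i) (j := j + 1) (by omega) (by omega),
      mul_assoc, mul_assoc, simpleTransposition_comm h]
    split_ifs <;> rfl
  braid i := by
    refine MulOpposite.unop_injective (LinearMap.ext fun f => funext fun w => ?_)
    change nilGenEnd i (nilGenEnd (i + 1) (nilGenEnd i f)) w =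
      nilGenEnd (i + 1) (nilGenEnd i (nilGenEnd (i + 1) f)) w
    have e1 (v : SInf) : (v * simpleTransposition i).1 (i + 1 + 1) = v.1 (i + 1 + 1) :=
      mul_simpleTransposition_apply_of_ne v (by omega) (by omega)
    have e2 (v : SInf) : (v * simpleTransposition (i + 1)).1 i = v.1 i :=
      mul_simpleTransposition_apply_of_ne v (by omega) (by omega)
    simp only [nilGenEnd_apply, e1, e2, mul_simpleTransposition_apply_left,
      mul_simpleTransposition_apply_right]
    have hb : w * simpleTransposition i * simpleTransposition (i + 1) * simpleTransposition i =
        w * simpleTransposition (i + 1) * simpleTransposition i * simpleTransposition (i + 1) := by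
      have := simpleTransposition_braid i
      simp only [mul_assoc] at this ⊢
      rw [this]
    rw [hb]
    split_ifs <;> rfl

open scoped Classical in
/-- The coefficient of `u_w` in an element of the nilCoxeter algebra. -/
noncomputable def nilCoeff (P : (Module.End Poly (SInf → Poly))ᵐᵒᵖ) (w : SInf) : Poly :=
  P.unop (fun v => if v = 1 then 1 else 0) w

open scoped Classical in
theorem nilCoeff_one (w : SInf) : nilCoeff 1 w = if w = 1 then 1 else 0 := rfl

theorem nilCoeff_mul_nilExp (P : (Module.End Poly (SInf → Poly))ᵐᵒᵖ) (i : ℕ) (a : Poly)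
    (w : SInf) :
    nilCoeff (P * nilExp nilGen i a) w = nilCoeff P w +
      a * if w.1 (i + 1) < w.1 i then nilCoeff P (w * simpleTransposition i) else 0 := by
  simp only [nilCoeff, nilExp, mul_add, mul_one, mul_smul_comm, MulOpposite.unop_add,
    MulOpposite.unop_smul, MulOpposite.unop_mul, nilGen, MulOpposite.unop_op, LinearMap.add_apply,
    LinearMap.smul_apply, Pi.add_apply, Pi.smul_apply, Module.End.mul_apply, nilGenEnd_apply,
    smul_eq_mul]

end NilCoxeterModule

/-! ### Subword sums as nilCoxeter coefficients -/

section SubwordSum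

theorem subwordSum_append_singleton (ω : List Letter) (a : Letter) (w : SInf) :
    subwordSum (ω ++ [a]) (reducedWords w) = subwordSum ω (reducedWords w) +
      a.weight * if w.1 (a.value + 1) < w.1 a.value then
        subwordSum ω (reducedWords (w * simpleTransposition a.value)) else 0 := by
  classical
  simp only [subwordSum, List.sublists_concat, List.filter_append, List.map_append,
    List.sum_append, List.filter_map, List.map_map]
  congr 1
  split_ifs with h
  · rw [← List.sum_map_mul_left]
    have : (fun π : List Letter => decide (π.map Letter.value ∈ reducedWords w)) ∘
        (fun x => x ++ [a]) = fun π : List Letter =>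
          decide (π.map Letter.value ∈ reducedWords (w * simpleTransposition a.value)) := by
      funext π
      simp [append_mem_reducedWords_iff, h]
    rw [this]
    congr 1
    refine List.map_congr_left fun π _ => ?_
    simp [wordWeight, mul_comm]
  · rw [List.filter_eq_nil_iff.2]
    · simp
    · intro π _
      simp [append_mem_reducedWords_iff, h]

theorem subwordSum_nil (w : SInf) [Decidable (w = 1)] :
    subwordSum [] (reducedWords w) = if w = 1 then 1 else 0 := by
  classical
  by_cases h : w = 1 <;>
    simp [subwordSum, wordWeight, nil_mem_reducedWords_iff, h]

/-- The product over the letters of `ω` of the factors `1 + φ(wt) u_value`. -/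
noncomputable def wordProd (φ : Poly →+* Poly) (ω : List Letter) :
    (Module.End Poly (SInf → Poly))ᵐᵒᵖ :=
  (ω.map fun a => nilExp nilGen a.value (φ a.weight)).prod

/-- Both sides satisfy the same recursion on the last letter. The homomorphism `φ` covers at once
the identity, the specialization `x = t` and the action of `s_i`. -/
theorem map_subwordSum (φ : Poly →+* Poly) (ω : List Letter) (w : SInf) :
    φ (subwordSum ω (reducedWords w)) = nilCoeff (wordProd φ ω) w := by
  classical
  induction ω using List.reverseRecOn generalizing w with
  | nil =>
    rw [subwordSum_nil, wordProd, List.map_nil, List.prod_nil, nilCoeff_one]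
    split_ifs <;> simp
  | append_singleton ω a ih =>
    rw [subwordSum_append_singleton, wordProd, List.map_append, List.prod_append, ← wordProd,
      List.map_singleton, List.prod_singleton, nilCoeff_mul_nilExp, map_add, map_mul, ih]
    split_ifs
    · rw [ih]
    · rw [map_zero]

theorem descProd_eq_prod {R A : Type*} [CommRing R] [Ring A] [Algebra R A] (u : ℕ → A) (t : ℕ → R)
    (x : R) (m d : ℕ) :
    descProd u t x m d = ((List.range' m d).reverse.map fun j => nilExp u j (x - t j)).prod := by
  induction d generalizing m with
  | zero => simp [descProd]
  | succ d ih => simp [descProd, ih, List.range'_succ]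

theorem ascProd_eq_prod {R A : Type*} [CommRing R] [Ring A] [Algebra R A] (u : ℕ → A) (t : ℕ → R)
    (c : R) (m d : ℕ) :
    ascProd u t c m d = ((List.range' m d).map fun j => nilExp u j (t j - c)).prod := by
  induction d generalizing m with
  | zero => simp [ascProd]
  | succ d ih => simp [ascProd, ih, List.range'_succ]

theorem wordProd_longWord (φ : Poly →+* Poly) (hφ : ∀ j, φ (tv j) = tv j) (n : ℕ) :
    wordProd φ (longWord n) =
      ((List.range n).map fun k => syllableProd nilGen tv n k (φ (xv k))).prod := by
  rw [wordProd, longWord, List.map_flatMap, List.flatMap_def, List.prod_flatten, List.map_map]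
  congr 1
  refine List.map_congr_left fun k _ => ?_
  simp [syllableWord, syllableProd, descProd_eq_prod, ascProd_eq_prod, Letter.weight, hφ,
    Function.comp_def]

theorem evalAtT_subwordSum_longWord (n : ℕ) (w : SInf) [Decidable (w = 1)] :
    evalAtT (subwordSum (longWord n) (reducedWords w)) = if w = 1 then 1 else 0 := by
  let φ : Poly →+* Poly := (MvPolynomial.aeval (R := ℤ) (Sum.elim tv tv)).toRingHom
  have hx (j : ℕ) : φ (xv j) = tv j := by simp [φ, xv]
  have ht (j : ℕ) : φ (tv j) = tv j := by simp [φ, tv]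
  change φ _ = _
  rw [map_subwordSum, wordProd_longWord φ ht, List.prod_eq_one, nilCoeff_one]
  · congr
  · intro b hb
    obtain ⟨k, hk, rfl⟩ := List.mem_map.1 hb
    rw [hx, isNilCoxeter_nilGen.syllableProd_self tv (List.mem_range.1 hk)]

theorem act_subwordSum_longWord (n i : ℕ) (w : SInf) :
    act (simpleTransposition i) (subwordSum (longWord n) (reducedWords w)) =
      nilCoeff ((List.range n).map fun k =>
        syllableProd nilGen tv n k (xv (Equiv.swap i (i + 1) k))).prod w := by
  let φ : Poly →+* Poly :=
    (MvPolynomial.rename (R := ℤ) (Sum.map (simpleTransposition i).1 id)).toRingHom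
  have hx (j : ℕ) : φ (xv j) = xv (Equiv.swap i (i + 1) j) := by
    simp [φ, xv, simpleTransposition]
  have ht (j : ℕ) : φ (tv j) = tv j := by simp [φ, tv]
  change φ _ = _
  simp only [map_subwordSum, wordProd_longWord φ ht, hx]

theorem subwordSum_longWord_eq (n : ℕ) (w : SInf) :
    subwordSum (longWord n) (reducedWords w) =
      nilCoeff ((List.range n).map fun k => syllableProd nilGen tv n k (xv k)).prod w := by
  have := map_subwordSum (RingHom.id Poly) (longWord n) w
  rwa [wordProd_longWord _ fun _ => rfl] at this

theorem xv_sub_xv_ne_zero (i : ℕ) : xv i - xv (i + 1) ≠ 0 := by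
  rw [sub_ne_zero, xv, xv, Ne, MvPolynomial.X_inj]
  simp

theorem dividedDifference_eq_iff (i : ℕ) (f g : Poly) :
    dividedDifference i f = g ↔
      (xv i - xv (i + 1)) * g = f - act (simpleTransposition i) f := by
  rw [← dividedDifference_spec]
  exact ⟨fun h => by rw [h], fun h => (mul_left_cancel₀ (xv_sub_xv_ne_zero i) h).symm⟩

theorem dividedDifference_subwordSum_longWord {n : ℕ} {w : SInf}
    (hw : w ∈ symmetricSubgroup (n + 1)) (i : ℕ) :
    dividedDifference i (subwordSum (longWord n) (reducedWords w)) =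
      if length (w * simpleTransposition i) < length w then
        subwordSum (longWord n) (reducedWords (w * simpleTransposition i)) else 0 := by
  rw [dividedDifference_eq_iff, act_subwordSum_longWord]
  simp only [length_mul_simpleTransposition_lt_iff, subwordSum_longWord_eq]
  rcases Nat.lt_or_ge i n with hi | hi
  · rw [isNilCoxeter_nilGen.prod_syllableProd_swap tv xv hi, nilCoeff_mul_nilExp]
    ring
  -- For `i ≥ n` there is no descent at `i`, and the long word involves only `x_k` with `k < n`, so
  -- `s_i` fixes the sum.
  · rw [if_neg fun h => absurd (lt_of_descent hw h) (by omega), mul_zero, eq_comm, sub_eq_zero]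
    congr 2
    refine List.map_congr_left fun k hk => ?_
    rw [List.mem_range] at hk
    rw [Equiv.swap_apply_of_ne_of_ne (by omega) (by omega)]

theorem isHomogeneous_weight (a : Letter) : a.weight.IsHomogeneous 1 := by
  rw [Letter.weight]
  split_ifs <;> exact (MvPolynomial.isHomogeneous_X _ _).sub (MvPolynomial.isHomogeneous_X _ _)

theorem isHomogeneous_wordWeight (π : List Letter) : (wordWeight π).IsHomogeneous π.length := by
  induction π with
  | nil => exact MvPolynomial.isHomogeneous_one _ _
  | cons a π ih =>
    rw [wordWeight, List.map_cons, List.prod_cons, List.length_cons, add_comm]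
    exact (isHomogeneous_weight a).mul ih

theorem isHomogeneous_subwordSum (ω : List Letter) (w : SInf) :
    (subwordSum ω (reducedWords w)).IsHomogeneous (length w) := by
  classical
  refine (MvPolynomial.homogeneousSubmodule (ℕ ⊕ ℕ) ℤ (length w)).toAddSubmonoid.list_sum_mem ?_
  intro f hf
  obtain ⟨π, hπ, rfl⟩ := List.mem_map.1 hf
  have h := (of_decide_eq_true (List.mem_filter.1 hπ).2).2
  rw [List.length_map] at h
  rw [← h]
  exact isHomogeneous_wordWeight π

end SubwordSum

/-! ### Uniqueness, stability in `n` and existence -/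

section Uniqueness

/-- If `x_j` occurred, invariance under `s_j, s_{j+1}, …` would force every later `x` to occur as
well. -/
theorem inl_notMem_vars {D : Poly} (hD : ∀ i, act (simpleTransposition i) D = D) (j : ℕ) :
    Sum.inl j ∉ D.vars := by
  intro hj
  have hstep : ∀ j, Sum.inl j ∈ D.vars → Sum.inl (j + 1) ∈ D.vars := by
    intro j hj
    rw [← hD j, act] at hj
    obtain ⟨v | v, hv, hvj⟩ := MvPolynomial.mem_vars_rename _ _ hj
    · have h : Equiv.swap j (j + 1) v = j := Sum.inl.inj hvj
      have : v = j + 1 := by simpa [Equiv.swap_apply_eq_iff] using h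
      rwa [← this]
    · simp at hvj
  have hall : ∀ k, Sum.inl (j + k) ∈ D.vars := fun k => by
    induction k with
    | zero => exact hj
    | succ k ih => exact hstep _ ih
  have hinj : Function.Injective fun k : ℕ => (Sum.inl (j + k) : ℕ ⊕ ℕ) := fun a b hab => by
    simpa using hab
  exact Set.infinite_of_injective_forall_mem hinj hall D.vars.finite_toSet

theorem eq_zero_of_symmetric {D : Poly} (hD : ∀ i, act (simpleTransposition i) D = D)
    (h0 : evalAtT D = 0) : D = 0 := by
  rw [← h0, evalAtT]
  refine MvPolynomial.hom_congr_vars (f₁ := RingHom.id Poly)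
    (f₂ := (MvPolynomial.aeval (R := ℤ) (Sum.elim tv tv)).toRingHom) (RingHom.ext_int _ _) ?_ rfl
  rintro (j | j) hj -
  · exact absurd hj (inl_notMem_vars hD j)
  · simp [tv]

/-- The normalization and the divided difference recursion determine a family on any set of
permutations that is closed under passing from `w` to a shorter `w s_i`. -/
theorem eq_of_recursion {W : Set SInf} {S T : SInf → Poly}
    (hW : ∀ w ∈ W, ∀ i, length (w * simpleTransposition i) < length w →
      w * simpleTransposition i ∈ W)
    (h0 : ∀ w ∈ W, evalAtT (S w) = evalAtT (T w))
    (hS : ∀ w ∈ W, ∀ i, dividedDifference i (S w) =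
      if length (w * simpleTransposition i) < length w then S (w * simpleTransposition i) else 0)
    (hT : ∀ w ∈ W, ∀ i, dividedDifference i (T w) =
      if length (w * simpleTransposition i) < length w then T (w * simpleTransposition i) else 0)
    {w : SInf} (hw : w ∈ W) : S w = T w := by
  induction hl : length w using Nat.strong_induction_on generalizing w with
  | _ l ih =>
  subst hl
  rw [← sub_eq_zero]
  refine eq_zero_of_symmetric (fun i => ?_) ?_
  · have hd : dividedDifference i (S w) = dividedDifference i (T w) := by
      rw [hS w hw, hT w hw]
      split_ifs with h
      · exact ih _ h (hW w hw i h) rfl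
      · rfl
    have h1 := dividedDifference_spec i (S w)
    have h2 := dividedDifference_spec i (T w)
    rw [hd, h2] at h1
    have h3 : act (simpleTransposition i) (S w - T w) =
        act (simpleTransposition i) (S w) - act (simpleTransposition i) (T w) := by
      simp only [act, map_sub]
    rw [h3]
    linear_combination h1
  · have h := h0 w hw
    simp only [evalAtT, map_sub] at h ⊢
    rw [h, sub_self]

theorem symmetricSubgroup_descent_closed (n : ℕ) :
    ∀ w ∈ (symmetricSubgroup (n + 1) : Set SInf), ∀ i,
      length (w * simpleTransposition i) < length w →
        w * simpleTransposition i ∈ (symmetricSubgroup (n + 1) : Set SInf) := fun w hw i h =>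
  mul_simpleTransposition_mem hw
    (lt_of_descent hw ((length_mul_simpleTransposition_lt_iff w i).1 h))

theorem symmetricSubgroup_mono {m n : ℕ} (h : m ≤ n) :
    symmetricSubgroup m ≤ symmetricSubgroup n := fun _ hw i hi => hw i (h.trans hi)

/-- Both long words solve the recursion on `S_{m+1}`, so uniqueness there replaces any combinatorial
comparison of subwords. -/
theorem subwordSum_longWord_stable {m n : ℕ} (h : m ≤ n) {w : SInf}
    (hw : w ∈ symmetricSubgroup (m + 1)) :
    subwordSum (longWord m) (reducedWords w) = subwordSum (longWord n) (reducedWords w) := by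
  classical
  exact eq_of_recursion (S := fun w => subwordSum (longWord m) (reducedWords w))
    (T := fun w => subwordSum (longWord n) (reducedWords w))
    (symmetricSubgroup_descent_closed m)
    (fun w _ => by rw [evalAtT_subwordSum_longWord, evalAtT_subwordSum_longWord])
    (fun w hw i => dividedDifference_subwordSum_longWord hw i)
    (fun w hw i => dividedDifference_subwordSum_longWord
      (symmetricSubgroup_mono (by omega) hw) i) hw

theorem IsDoubleSchubertFamily.eq_subwordSum {S : SInf → Poly} (hS : IsDoubleSchubertFamily S)
    {n : ℕ} {w : SInf} (hw : w ∈ symmetricSubgroup (n + 1)) :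
    S w = subwordSum (longWord n) (reducedWords w) := by
  classical
  exact eq_of_recursion (T := fun w => subwordSum (longWord n) (reducedWords w))
    (symmetricSubgroup_descent_closed n)
    (fun w _ => by rw [evalAtT_subwordSum_longWord, hS.normalization])
    (fun w _ i => hS.recursion w i)
    (fun w hw i => dividedDifference_subwordSum_longWord hw i) hw

theorem exists_isDoubleSchubertFamily : ∃ S : SInf → Poly, IsDoubleSchubertFamily S := by
  classical
  have hex (w : SInf) : ∃ n, w ∈ symmetricSubgroup (n + 1) := by
    obtain ⟨n, hn⟩ := exists_mem_symmetricSubgroup w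
    exact ⟨n, symmetricSubgroup_mono (Nat.le_succ n) hn⟩
  choose N hN using hex
  refine ⟨fun w => subwordSum (longWord (N w)) (reducedWords w),
    fun w => ⟨_, isHomogeneous_subwordSum _ w⟩,
    fun w => by rw [evalAtT_subwordSum_longWord], fun w i => ?_⟩
  rw [dividedDifference_subwordSum_longWord (hN w)]
  split_ifs with h
  -- The chosen sizes for `w` and `w s_i` may differ; both sums are compared with the one at their
  -- maximum.
  · have h1 := symmetricSubgroup_descent_closed _ w (hN w) i h
    rw [subwordSum_longWord_stable (le_max_left (N w) (N (w * simpleTransposition i))) h1,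
      subwordSum_longWord_stable (le_max_right (N w) _) (hN (w * simpleTransposition i))]
  · rfl

end Uniqueness

end VineModel

/-- There is exactly one family with the properties characterizing double Schubert polynomials,
and its member at `w ∈ S_{n+1}` is the weighted sum over the subwords of the long word that are
reduced words of `w`. -/
theorem theorem6p1 :
    (∃! S : VineModel.SInf → VineModel.Poly, VineModel.IsDoubleSchubertFamily S) ∧
    ∀ S : VineModel.SInf → VineModel.Poly, VineModel.IsDoubleSchubertFamily S →
      ∀ (n : ℕ) (w : VineModel.SInf), w ∈ VineModel.symmetricSubgroup (n + 1) →
        S w = VineModel.subwordSum (VineModel.longWord n) (VineModel.reducedWords w) := by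
  refine ⟨?_, fun S hS n w hw => hS.eq_subwordSum hw⟩
  obtain ⟨S, hS⟩ := VineModel.exists_isDoubleSchubertFamily
  refine ⟨S, hS, fun T hT => funext fun w => ?_⟩
  obtain ⟨n, hn⟩ := VineModel.exists_mem_symmetricSubgroup w
  have hn' := VineModel.symmetricSubgroup_mono (Nat.le_succ n) hn
  rw [hS.eq_subwordSum hn', hT.eq_subwordSum hn']
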